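/- **Setting.** Let $\emptyset\neq\Omega\subseteq\mathbb R^d$ be a bounded domain (open and connected) with the extension property: every function in $H^1(\Omega;\mathbb C)$ is the restriction to $\Omega$ of a function in $H^1(\mathbb R^d;\mathbb C)$. Let $N\ge 1$, and let $A_1,\dots,A_N:\Omega\to\mathbb R^{d\times d}$ and $V:\Omega\to\mathbb C^{N\times N}$ be measurable and bounded. Assume that there is a constant $\nu>0$ such that for all $k\in\{1,\dots,N\}$ and almost all $x\in\Omega$, $$\operatorname{Re}\big(\xi^{T}A_k(x)\overline{\xi}\big)\ \ge\ \nu\,\|\xi\|_2^2\qquad\text{for all }\xi\in\mathbb C^d .$$ For each $k$ let $a_k(u,v)=\int_\Omega (\nabla u)^{T}A_k\nabla\overline v\,\mathrm dx$ for $u,v\in H^1(\Omega;\mathbb C)$, and let $-\mathcal A_k$ be the operator on $L^2(\Omega;\mathbb C)$ induced by the form $a_k$; that is, $u\in D(\mathcal A_k)$ and $\mathcal A_ku=f$ if and only if $u\in H^1(\Omega;\mathbb C)$, $f\in L^2(\Omega;\mathbb C)$ and $a_k(u,v)=-\int_\Omega f\,\overline v\,\mathrm dx$ for all $v\in H^1(\Omega;\mathbb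 C)$. (So $\mathcal A_k$ is the realization of $u\mapsto\operatorname{div}(A_k\nabla u)$ with Neumann boundary conditions.) Let $\mathcal B_2=\operatorname{diag}(\mathcal A_1,\dots,\mathcal A_N)$ on $L^2(\Omega;\mathbb C^N)$, with domain $\{u: u_k\in D(\mathcal A_k)\text{ for all }k\}$, and write $V$ also for the bounded operator of multiplication by $V$ on $L^2(\Omega;\mathbb C^N)$, so that $\mathcal B_2+V$ has the domain $D(\mathcal B_2)$. A matrix $M\in\mathbb C^{N\times N}$ is called dissipative with respect to the $\ell^2$-norm if $\|(\mu-M)z\|_2\ge\mu\|z\|_2$ for all $\mu>0$ and $z\in\mathbb C^N$. **Proposition.** Suppose that, for almost all $x\in\Omega$, the matrix $V(x)$ is dissipative with respect to the $\ell^2$-norm on $\mathbb C^N$. Then for each $\beta\in\mathbb R$ the following assertions are equivalent: (i) The number $\mathrm i\beta$ is an eigenvalue of $\mathcal B_2+V$. (ii) There exists a measurable subset $\widetilde\Omega\subseteq\Omega$ of full measure (i.e. $\Omega\setminus\widetilde\Omega$ has Lebesgue measure $0$) such that $$\bigcap_{x\in\widetilde\Omega}\ker\big(\mathrm i\beta-V(x)\big)\neq\{0\}.$$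 In this case, each component function of every eigenvector $u\in\ker\big(\mathrm i\beta-(\mathcal B_2+V)\big)$ is constant almost everywhere on $\Omega$. -/

import Mathlib

open MeasureTheory
open scoped Distributions InnerProductSpace

noncomputable section

namespace CoupledHeat

/-! ### Abstract operators -/

section Abstract

/-- A linear operator on a normed space is dissipative if `‖(μ - T) x‖ ≥ μ ‖x‖` for all
`μ > 0` and all `x`. -/
def IsDissipative {F : Type*} [NormedAddCommGroup F] [NormedSpace ℂ F] (T : F →ₗ[ℂ] F) : Prop :=
  ∀ μ : ℝ, 0 < μ → ∀ x : F, μ * ‖x‖ ≤ ‖(μ : ℂ) • x - T x‖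

/-- `u` is an eigenvector of the (unbounded) operator `T` for the eigenvalue `μ`. -/
def IsEigenvector {F : Type*} [AddCommGroup F] [Module ℂ F] (T : F →ₗ.[ℂ] F) (μ : ℂ) (u : F) :
    Prop :=
  u ≠ 0 ∧ ∃ hu : u ∈ T.domain, T ⟨u, hu⟩ = μ • u

/-- The set of all eigenvalues of the (unbounded) operator `T`. -/
def pointSpectrum {F : Type*} [AddCommGroup F] [Module ℂ F] (T : F →ₗ.[ℂ] F) : Set ℂ :=
  {μ | ∃ u, IsEigenvector T μ u}

variable {H : Type*} [NormedAddCommGroup H] [InnerProductSpace ℂ H]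

/-- The graph of the operator induced by the sesquilinear form `a` with form domain `D`:
all `(u, f)` with `u ∈ D` and `a(u, v) = (f | v)` for all `v ∈ D`, where `(f | v)` is linear
in `f`. -/
def formGraph (D : Submodule ℂ H) (a : D →ₗ[ℂ] D →ₗ⋆[ℂ] ℂ) : Submodule ℂ (H × H) where
  carrier := {p | ∃ u : D, (u : H) = p.1 ∧ ∀ v : D, a u v = ⟪(v : H), p.2⟫_ℂ}
  zero_mem' := ⟨0, rfl, fun v => by simp⟩
  add_mem' := by
    rintro p q ⟨u, hu, hu'⟩ ⟨w, hw, hw'⟩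
    exact ⟨u + w, by simp [hu, hw], fun v => by simp [hu', hw']⟩
  smul_mem' := by
    rintro c p ⟨u, hu, hu'⟩
    exact ⟨c • u, by simp [hu], fun v => by simp [hu']⟩

/-- The operator induced by a sesquilinear form with dense form domain. -/
def formOperator (D : Submodule ℂ H) (a : D →ₗ[ℂ] D →ₗ⋆[ℂ] ℂ) : H →ₗ.[ℂ] H :=
  (formGraph D a).toLinearPMap

theorem formOperator_graph (D : Submodule ℂ H) (hD : Dense (D : Set H))
    (a : D →ₗ[ℂ] D →ₗ⋆[ℂ] ℂ) : (formOperator D a).graph = formGraph D a := by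
  refine Submodule.toLinearPMap_graph_eq _ ?_
  rintro ⟨u, f⟩ ⟨w, hw, h⟩ (rfl : u = 0)
  have hw0 : w = 0 := Subtype.ext hw
  subst hw0
  exact hD.eq_zero_of_inner_right (𝕜 := ℂ) fun v hv => by simpa using (h ⟨v, hv⟩).symm

end Abstract

/-! ### Lebesgue and Sobolev spaces -/

section Spaces

variable {d : ℕ}

/-- `L²(Ω; F)` with respect to the Lebesgue measure. -/
abbrev L2 (Ω : TopologicalSpace.Opens (EuclideanSpace ℝ (Fin d))) (F : Type*)
    [NormedAddCommGroup F] : Type _ :=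
  Lp F 2 ((volume : Measure (EuclideanSpace ℝ (Fin d))).restrict Ω)

variable (Ω : TopologicalSpace.Opens (EuclideanSpace ℝ (Fin d)))

theorem integrable_smul_of_memLp {F : Type*} [NormedAddCommGroup F] [NormedSpace ℝ F]
    (ψ : EuclideanSpace ℝ (Fin d) → ℝ) (hc : Continuous ψ) (hs : HasCompactSupport ψ)
    {f : EuclideanSpace ℝ (Fin d) → F} (hf : MemLp f 2 (volume.restrict (Ω : Set _))) :
    Integrable (fun x => ψ x • f x) (volume.restrict (Ω : Set _)) := by
  have h := MemLp.smul (r := 1) hf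
    ((hc.memLp_of_hasCompactSupport (p := 2) (μ := volume) hs).restrict (Ω : Set _))
  exact memLp_one_iff_integrable.1 h

theorem _root_.TestFunction.continuous_partial (φ : 𝓓(Ω, ℝ)) (v : EuclideanSpace ℝ (Fin d)) :
    Continuous fun x => fderiv ℝ φ x v :=
  (φ.contDiff.continuous_fderiv (by simp)).clm_apply continuous_const

theorem _root_.TestFunction.hasCompactSupport_partial (φ : 𝓓(Ω, ℝ))
    (v : EuclideanSpace ℝ (Fin d)) : HasCompactSupport fun x => fderiv ℝ φ x v :=
  φ.hasCompactSupport.fderiv_apply ℝ v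

/-- The graph of the weak gradient on `L²(Ω; ℂ)`: all pairs `(u, G)` of square integrable
functions such that `∫ u ∂ᵢφ = - ∫ Gᵢ φ` for all test functions `φ` on `Ω` and all `i`. -/
def weakGradientGraph : Submodule ℂ (L2 Ω ℂ × L2 Ω (EuclideanSpace ℂ (Fin d))) where
  carrier := {p | ∀ (φ : 𝓓(Ω, ℝ)) (i : Fin d),
    ∫ x in Ω, fderiv ℝ φ x (EuclideanSpace.single i 1) • p.1 x = - ∫ x in Ω, φ x • p.2 x i}
  zero_mem' := by
    intro φ i
    have h1 : ∀ᵐ x ∂(volume.restrict (Ω : Set (EuclideanSpace ℝ (Fin d)))),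
        (0 : L2 Ω ℂ) x = 0 := Lp.coeFn_zero _ _ _
    have h2 : ∀ᵐ x ∂(volume.restrict (Ω : Set (EuclideanSpace ℝ (Fin d)))),
        (0 : L2 Ω (EuclideanSpace ℂ (Fin d))) x = 0 := Lp.coeFn_zero _ _ _
    rw [integral_eq_zero_of_ae, integral_eq_zero_of_ae, neg_zero]
    · filter_upwards [h2] with x hx
      simp only [Prod.snd_zero, hx, PiLp.zero_apply, smul_zero, Pi.zero_apply]
    · filter_upwards [h1] with x hx
      simp only [Prod.fst_zero, hx, smul_zero, Pi.zero_apply]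
  add_mem' := by
    rintro ⟨u, G⟩ ⟨w, K⟩ h h' φ i
    have e1 : ∫ x in Ω, fderiv ℝ φ x (EuclideanSpace.single i 1) • (u + w) x =
        ∫ x in Ω, (fderiv ℝ φ x (EuclideanSpace.single i 1) • u x +
          fderiv ℝ φ x (EuclideanSpace.single i 1) • w x) := by
      refine integral_congr_ae ?_
      filter_upwards [Lp.coeFn_add u w] with x hx
      simp only [hx, Pi.add_apply, smul_add]
    have e2 : ∫ x in Ω, φ x • (G + K) x i = ∫ x in Ω, (φ x • G x i + φ x • K x i) := by
      refine integral_congr_ae ?_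
      filter_upwards [Lp.coeFn_add G K] with x hx
      simp only [hx, Pi.add_apply, PiLp.add_apply, smul_add]
    have hGi : ∀ G : L2 Ω (EuclideanSpace ℂ (Fin d)),
        MemLp (fun x => G x i) 2 (volume.restrict (Ω : Set (EuclideanSpace ℝ (Fin d)))) := fun G =>
      (EuclideanSpace.proj i : EuclideanSpace ℂ (Fin d) →L[ℂ] ℂ).comp_memLp' (Lp.memLp G)
    have hd := φ.continuous_partial Ω (EuclideanSpace.single i 1)
    have hs := φ.hasCompactSupport_partial Ω (EuclideanSpace.single i 1)
    change ∫ x in Ω, fderiv ℝ φ x (EuclideanSpace.single i 1) • (u + w) x =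
      - ∫ x in Ω, φ x • (G + K) x i
    rw [e1, e2, integral_add (integrable_smul_of_memLp Ω _ hd hs (Lp.memLp u))
      (integrable_smul_of_memLp Ω _ hd hs (Lp.memLp w)),
      integral_add (integrable_smul_of_memLp Ω _ φ.continuous φ.hasCompactSupport (hGi G))
      (integrable_smul_of_memLp Ω _ φ.continuous φ.hasCompactSupport (hGi K)), neg_add]
    exact congrArg₂ _ (h φ i) (h' φ i)
  smul_mem' := by
    rintro c ⟨u, G⟩ h φ i
    have e1 : ∫ x in Ω, fderiv ℝ φ x (EuclideanSpace.single i 1) • (c • u) x =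
        c * ∫ x in Ω, fderiv ℝ φ x (EuclideanSpace.single i 1) • u x := by
      rw [← integral_const_mul]
      refine integral_congr_ae ?_
      filter_upwards [Lp.coeFn_smul c u] with x hx
      simp [hx, mul_left_comm]
    have e2 : ∫ x in Ω, φ x • (c • G) x i = c * ∫ x in Ω, φ x • G x i := by
      rw [← integral_const_mul]
      refine integral_congr_ae ?_
      filter_upwards [Lp.coeFn_smul c G] with x hx
      simp [hx, mul_left_comm]
    change ∫ x in Ω, fderiv ℝ φ x (EuclideanSpace.single i 1) • (c • u) x =
      - ∫ x in Ω, φ x • (c • G) x i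
    rw [e1, e2, ← mul_neg]
    exact congrArg _ (h φ i)

/-- The weak gradient, as an operator on `L²(Ω; ℂ)` with domain `H¹(Ω; ℂ)`. -/
def weakGradient : L2 Ω ℂ →ₗ.[ℂ] L2 Ω (EuclideanSpace ℂ (Fin d)) :=
  (weakGradientGraph Ω).toLinearPMap

/-- The Sobolev space `H¹(Ω; ℂ)`: the functions in `L²(Ω; ℂ)` with a square integrable weak
gradient. -/
abbrev H1 : Submodule ℂ (L2 Ω ℂ) := (weakGradient Ω).domain

/-- If the pairing with every test function vanishes, then so does the function. -/
theorem ae_eq_zero_of_testFunction {f : EuclideanSpace ℝ (Fin d) → ℂ}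
    (hf : MemLp f 2 (volume.restrict (Ω : Set _)))
    (h : ∀ φ : 𝓓(Ω, ℝ), ∫ x in Ω, φ x • f x = 0) :
    f =ᵐ[volume.restrict (Ω : Set _)] 0 := by
  have hloc : LocallyIntegrableOn f Ω volume := by
    rw [locallyIntegrableOn_iff Ω.isOpen.isLocallyClosed]
    intro k hk hkc
    have hfk := hf.mono_measure (Measure.restrict_mono hk le_rfl)
    have : IsFiniteMeasure (volume.restrict k) := ⟨by simpa using hkc.measure_lt_top⟩
    exact hfk.integrable (by norm_num)
  have := Ω.isOpen.ae_eq_zero_of_integral_contDiff_smul_eq_zero hloc (fun g hg hgs hgt => by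
    rw [← h ⟨g, hg, hgs, hgt⟩]
    refine (setIntegral_eq_integral_of_forall_compl_eq_zero fun x hx => ?_).symm
    have : g x = 0 := by
      by_contra hne
      exact hx (hgt (subset_tsupport g hne))
    change g x • f x = 0
    rw [this, zero_smul])
  exact (ae_restrict_iff' Ω.isOpen.measurableSet).2 this

theorem weakGradient_graph : (weakGradient Ω).graph = weakGradientGraph Ω := by
  refine Submodule.toLinearPMap_graph_eq _ ?_
  rintro ⟨u, G⟩ h (rfl : u = 0)
  change G = 0
  have key : ∀ i, (fun x => G x i) =ᵐ[volume.restrict (Ω : Set _)] 0 := fun i => by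
    refine ae_eq_zero_of_testFunction Ω
      ((EuclideanSpace.proj i : EuclideanSpace ℂ (Fin d) →L[ℂ] ℂ).comp_memLp' (Lp.memLp G)) ?_
    intro φ
    have h1 := h φ i
    rw [integral_eq_zero_of_ae, eq_comm, neg_eq_zero] at h1
    · exact h1
    · filter_upwards [Lp.coeFn_zero ℂ 2 (volume.restrict (Ω : Set (EuclideanSpace ℝ (Fin d))))]
        with x hx
      simp only [hx, Pi.zero_apply, smul_zero]
  rw [Lp.eq_zero_iff_ae_eq_zero]
  filter_upwards [ae_all_iff.2 key] with x hx
  ext i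
  exact hx i

/-- `Ω` has the extension property: every function in `H¹(Ω; ℂ)` is the restriction of a
function in `H¹(ℝᵈ; ℂ)`. -/
def HasExtensionProperty : Prop :=
  ∀ u ∈ H1 Ω, ∃ w ∈ H1 (⊤ : TopologicalSpace.Opens (EuclideanSpace ℝ (Fin d))),
    ∀ᵐ x ∂(volume.restrict (Ω : Set (EuclideanSpace ℝ (Fin d)))), w x = u x

/-- The `L²`-function given by a test function. -/
def testToL2 (φ : 𝓓(Ω, ℝ)) : L2 Ω ℂ :=
  MemLp.toLp (fun x => (φ x : ℂ))
    (((φ.continuous.memLp_of_hasCompactSupport (p := 2) (μ := volume)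
      φ.hasCompactSupport).restrict _).ofReal)

theorem testToL2_mem_H1 (φ : 𝓓(Ω, ℝ)) : testToL2 Ω φ ∈ H1 Ω := by
  have hm : MemLp (fun x => WithLp.toLp 2 fun i : Fin d =>
      ((fderiv ℝ φ x (EuclideanSpace.single i 1) : ℝ) : ℂ)) 2
      (volume.restrict (Ω : Set (EuclideanSpace ℝ (Fin d)))) := by
    refine MemLp.of_eval_piLp fun i => ?_
    exact ((((φ.continuous_partial Ω _).memLp_of_hasCompactSupport (p := 2) (μ := volume)
      (φ.hasCompactSupport_partial Ω _)).restrict _).ofReal)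
  refine Submodule.mem_map.2 ⟨(testToL2 Ω φ, hm.toLp), ?_, rfl⟩
  intro ψ i
  have e1 : ∫ x in Ω, fderiv ℝ ψ x (EuclideanSpace.single i 1) • testToL2 Ω φ x =
      ((∫ x in Ω, φ x * fderiv ℝ ψ x (EuclideanSpace.single i 1) : ℝ) : ℂ) := by
    rw [← integral_complex_ofReal]
    refine integral_congr_ae ?_
    filter_upwards [MemLp.coeFn_toLp (((φ.continuous.memLp_of_hasCompactSupport (p := 2)
      (μ := volume) φ.hasCompactSupport).restrict (Ω : Set _)).ofReal (K := ℂ))] with x hx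
    have hx' : testToL2 Ω φ x = (φ x : ℂ) := hx
    rw [hx', Complex.real_smul, Complex.ofReal_mul, mul_comm]
  have e2 : ∫ x in Ω, ψ x • (hm.toLp : L2 Ω (EuclideanSpace ℂ (Fin d))) x i =
      ((∫ x in Ω, fderiv ℝ φ x (EuclideanSpace.single i 1) * ψ x : ℝ) : ℂ) := by
    rw [← integral_complex_ofReal]
    refine integral_congr_ae ?_
    filter_upwards [hm.coeFn_toLp] with x hx
    rw [hx, Complex.real_smul, Complex.ofReal_mul, mul_comm]
  have hφ0 : ∀ x ∉ (Ω : Set _), φ x = 0 := fun x hx => by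
    by_contra hne
    exact hx (φ.tsupport_subset (subset_tsupport φ hne))
  have hψ0 : ∀ x ∉ (Ω : Set _), ψ x = 0 := fun x hx => by
    by_contra hne
    exact hx (ψ.tsupport_subset (subset_tsupport ψ hne))
  change ∫ x in Ω, fderiv ℝ ψ x (EuclideanSpace.single i 1) • testToL2 Ω φ x = -
    ∫ x in Ω, ψ x • (hm.toLp : L2 Ω (EuclideanSpace ℂ (Fin d))) x i
  rw [e1, e2, setIntegral_eq_integral_of_forall_compl_eq_zero (fun x hx => by simp [hφ0 x hx]),
    setIntegral_eq_integral_of_forall_compl_eq_zero (fun x hx => by simp [hψ0 x hx]),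
    integral_mul_fderiv_eq_neg_fderiv_mul_of_integrable, Complex.ofReal_neg]
  · exact ((φ.continuous_partial Ω _).mul ψ.continuous).integrable_of_hasCompactSupport
      ((φ.hasCompactSupport_partial Ω _).mul_right)
  · exact (φ.continuous.mul (ψ.continuous_partial Ω _)).integrable_of_hasCompactSupport
      (φ.hasCompactSupport.mul_right)
  · exact (φ.continuous.mul ψ.continuous).integrable_of_hasCompactSupport
      (φ.hasCompactSupport.mul_right)
  · exact fun x _ => φ.contDiff.differentiable (by simp) x
  · exact fun x _ => ψ.contDiff.differentiable (by simp) x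

theorem dense_H1 : Dense (H1 Ω : Set (L2 Ω ℂ)) := by
  rw [Submodule.dense_iff_topologicalClosure_eq_top,
    Submodule.topologicalClosure_eq_top_iff, Submodule.eq_bot_iff]
  intro f hf
  rw [Lp.eq_zero_iff_ae_eq_zero]
  refine ae_eq_zero_of_testFunction Ω (Lp.memLp f) fun φ => ?_
  rw [← (Submodule.mem_orthogonal _ _).1 hf _ (testToL2_mem_H1 Ω φ), L2.inner_def]
  refine integral_congr_ae ?_
  filter_upwards [MemLp.coeFn_toLp (((φ.continuous.memLp_of_hasCompactSupport (p := 2)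
    (μ := volume) φ.hasCompactSupport).restrict (Ω : Set _)).ofReal (K := ℂ))] with x hx
  have hx' : testToL2 Ω φ x = (φ x : ℂ) := hx
  rw [hx']
  simp [mul_comm]

end Spaces

/-! ### The coupled system -/

section System

variable {d N : ℕ} (Ω : TopologicalSpace.Opens (EuclideanSpace ℝ (Fin d)))

/-- The matrix-valued function `M` is measurable and bounded on `Ω`. -/
structure IsBddMeas {𝕜 : Type*} [NormedField 𝕜] [MeasurableSpace 𝕜] {n : ℕ}
    (M : EuclideanSpace ℝ (Fin d) → Matrix (Fin n) (Fin n) 𝕜) : Prop where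
  measurable : ∀ i j, Measurable fun x : Ω => M x i j
  bounded : ∃ C : ℝ, ∀ x ∈ Ω, ∀ i j, ‖M x i j‖ ≤ C

variable {Ω}

theorem IsBddMeas.memLp {n : ℕ} {M : EuclideanSpace ℝ (Fin d) → Matrix (Fin n) (Fin n) ℂ}
    (hM : IsBddMeas Ω M) (u : L2 Ω (EuclideanSpace ℂ (Fin n))) :
    MemLp (fun x => (M x).toEuclideanLin (u x)) 2
      (volume.restrict (Ω : Set (EuclideanSpace ℝ (Fin d)))) := by
  obtain ⟨C, hC⟩ := hM.bounded
  refine MemLp.of_eval_piLp fun i => ?_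
  have hentry : ∀ j, MemLp (fun x => M x i j) ⊤
      (volume.restrict (Ω : Set (EuclideanSpace ℝ (Fin d)))) := fun j => by
    refine memLp_top_of_bound (aemeasurable_restrict_of_measurable_subtype
      Ω.isOpen.measurableSet (hM.measurable i j)).aestronglyMeasurable C ?_
    exact (ae_restrict_iff' Ω.isOpen.measurableSet).2 (.of_forall fun x hx => hC x hx i j)
  have hu : ∀ j, MemLp (fun x => u x j) 2
      (volume.restrict (Ω : Set (EuclideanSpace ℝ (Fin d)))) := fun j =>
    (EuclideanSpace.proj j : EuclideanSpace ℂ (Fin n) →L[ℂ] ℂ).comp_memLp' (Lp.memLp u)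
  have := memLp_finsetSum (p := 2) Finset.univ fun j (_ : j ∈ Finset.univ) =>
    (hu j).mul (r := 2) (hentry j)
  refine this.congr_norm ?_ (.of_forall fun x => ?_)
  · refine this.1.congr (.of_forall fun x => ?_)
    simp [Matrix.toLpLin_apply, Matrix.mulVec, dotProduct]
  · simp [Matrix.toLpLin_apply, Matrix.mulVec, dotProduct]

/-- The operator of multiplication with the bounded measurable matrix-valued function `M` on
`L²(Ω; ℂⁿ)`. -/
def mulOperator {n : ℕ} (M : EuclideanSpace ℝ (Fin d) → Matrix (Fin n) (Fin n) ℂ)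
    (hM : IsBddMeas Ω M) :
    L2 Ω (EuclideanSpace ℂ (Fin n)) →ₗ[ℂ] L2 Ω (EuclideanSpace ℂ (Fin n)) where
  toFun u := (hM.memLp u).toLp
  map_add' u v := by
    rw [← MemLp.toLp_add]
    refine MemLp.toLp_congr _ _ ?_
    filter_upwards [Lp.coeFn_add u v] with x hx
    simp only [hx, Pi.add_apply, map_add]
  map_smul' c u := by
    rw [RingHom.id_apply, ← MemLp.toLp_const_smul]
    refine MemLp.toLp_congr _ _ ?_
    filter_upwards [Lp.coeFn_smul c u] with x hx
    simp only [hx, Pi.smul_apply, map_smul]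

/-- The integrand `(∇u)ᵀ A ∇v̄` of the form at one point, for `ξ = ∇u(x)` and `η = ∇v(x)`. -/
def formIntegrand (A : Matrix (Fin d) (Fin d) ℝ) (ξ η : EuclideanSpace ℂ (Fin d)) : ℂ :=
  ∑ i, ∑ j, ξ i * (A i j : ℂ) * (starRingEnd ℂ) (η j)

theorem IsBddMeas.transpose_map {A : EuclideanSpace ℝ (Fin d) → Matrix (Fin d) (Fin d) ℝ}
    (hA : IsBddMeas Ω A) : IsBddMeas Ω fun x => (A x).transpose.map Complex.ofReal where
  measurable i j := Complex.measurable_ofReal.comp (hA.measurable j i)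
  bounded := by
    obtain ⟨C, hC⟩ := hA.bounded
    exact ⟨C, fun x hx i j => by simpa using hC x hx j i⟩

theorem integral_formIntegrand {A : EuclideanSpace ℝ (Fin d) → Matrix (Fin d) (Fin d) ℝ}
    (hA : IsBddMeas Ω A) (U W : L2 Ω (EuclideanSpace ℂ (Fin d))) :
    ∫ x in Ω, formIntegrand (A x) (U x) (W x) =
      ⟪W, mulOperator _ hA.transpose_map U⟫_ℂ := by
  rw [L2.inner_def]
  refine integral_congr_ae ?_
  filter_upwards [(hA.transpose_map.memLp U).coeFn_toLp] with x hx
  have hx' : mulOperator _ hA.transpose_map U x = _ := hx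
  rw [hx', formIntegrand, Finset.sum_comm]
  simp only [PiLp.inner_apply, RCLike.inner_apply, Matrix.toLpLin_apply, Matrix.mulVec, dotProduct,
    Finset.sum_mul, Matrix.map_apply, Matrix.transpose_apply]
  refine Finset.sum_congr rfl fun j _ => Finset.sum_congr rfl fun i _ => ?_
  ring

/-- The form `a(u, v) = ∫_Ω (∇u)ᵀ A ∇v̄ dx` on `H¹(Ω; ℂ)`. -/
def ellipticForm (A : EuclideanSpace ℝ (Fin d) → Matrix (Fin d) (Fin d) ℝ)
    (hA : IsBddMeas Ω A) : H1 Ω →ₗ[ℂ] H1 Ω →ₗ⋆[ℂ] ℂ :=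
  LinearMap.mk₂'ₛₗ (RingHom.id ℂ) (starRingEnd ℂ)
    (fun u v => ∫ x in Ω, formIntegrand (A x) (weakGradient Ω u x) (weakGradient Ω v x))
    (fun u₁ u₂ v => by
      simp only [integral_formIntegrand hA, LinearPMap.map_add, map_add, inner_add_right])
    (fun c u v => by
      simp only [integral_formIntegrand hA, LinearPMap.map_smul, map_smul, inner_smul_right,
        RingHom.id_apply, smul_eq_mul])
    (fun u v₁ v₂ => by
      simp only [integral_formIntegrand hA, LinearPMap.map_add, inner_add_left])
    (fun c u v => by
      simp only [integral_formIntegrand hA, LinearPMap.map_smul, inner_smul_left, smul_eq_mul])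

/-- The realization `𝒜` of `u ↦ div (A ∇u)` on `L²(Ω; ℂ)` with Neumann boundary conditions:
`-𝒜` is the operator induced by the form `ellipticForm`. -/
def neumannOperator (A : EuclideanSpace ℝ (Fin d) → Matrix (Fin d) (Fin d) ℝ)
    (hA : IsBddMeas Ω A) : L2 Ω ℂ →ₗ.[ℂ] L2 Ω ℂ :=
  -formOperator (H1 Ω) (ellipticForm A hA)

/-- The `k`-th component of a function in `L²(Ω; ℂᴺ)`. -/
def component (k : Fin N) : L2 Ω (EuclideanSpace ℂ (Fin N)) →L[ℂ] L2 Ω ℂ :=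
  (EuclideanSpace.proj k : EuclideanSpace ℂ (Fin N) →L[ℂ] ℂ).compLpL 2 _

/-- The embedding of `L²(Ω; ℂ)` as the `k`-th component into `L²(Ω; ℂᴺ)`. -/
def inclusion (k : Fin N) : L2 Ω ℂ →L[ℂ] L2 Ω (EuclideanSpace ℂ (Fin N)) :=
  (ContinuousLinearMap.toSpanSingleton ℂ
    (EuclideanSpace.single k (1 : ℂ) : EuclideanSpace ℂ (Fin N))).compLpL 2 _

/-- The diagonal operator `diag(T₁, …, T_N)` on `L²(Ω; ℂᴺ)`; its domain consists of all `u`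
such that each component `u_k` is in the domain of `T_k`. -/
def diagOperator (T : Fin N → L2 Ω ℂ →ₗ.[ℂ] L2 Ω ℂ) :
    L2 Ω (EuclideanSpace ℂ (Fin N)) →ₗ.[ℂ] L2 Ω (EuclideanSpace ℂ (Fin N)) where
  domain := ⨅ k, (T k).domain.comap (component k).toLinearMap
  toFun := ∑ k, (inclusion k).toLinearMap ∘ₗ (T k).toFun ∘ₗ
    (component k).toLinearMap.restrict (p := ⨅ k, (T k).domain.comap (component k).toLinearMap)
      fun _ hu => (Submodule.mem_iInf _).1 hu k

theorem component_inclusion (k l : Fin N) (f : L2 Ω ℂ) :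
    component k (inclusion (N := N) l f) = if k = l then f else 0 := by
  refine Lp.ext ?_
  have h1 := (EuclideanSpace.proj k : EuclideanSpace ℂ (Fin N) →L[ℂ] ℂ).coeFn_compLp
    (inclusion (N := N) l f)
  have h2 := (ContinuousLinearMap.toSpanSingleton ℂ
    (EuclideanSpace.single l (1 : ℂ) : EuclideanSpace ℂ (Fin N))).coeFn_compLp f
  have h3 := Lp.coeFn_zero ℂ 2 (volume.restrict (Ω : Set (EuclideanSpace ℝ (Fin d))))
  filter_upwards [h1, h2, h3] with x h1 h2 h3
  have h1' : component k (inclusion (N := N) l f) x = inclusion (N := N) l f x k := h1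
  have h2' : inclusion (N := N) l f x = f x • EuclideanSpace.single l (1 : ℂ) := h2
  rw [h1', h2']
  split_ifs with h
  · subst h; simp
  · rw [h3]; simp [h]

theorem component_diagOperator (T : Fin N → L2 Ω ℂ →ₗ.[ℂ] L2 Ω ℂ) (u : (diagOperator T).domain)
    (k : Fin N) :
    component k (diagOperator T u) =
      T k ⟨component k u, (Submodule.mem_iInf _).1 u.2 k⟩ := by
  have : diagOperator T u = ∑ l, inclusion l
      (T l ⟨component l u, (Submodule.mem_iInf _).1 u.2 l⟩) := by
    change (∑ k, (inclusion k).toLinearMap ∘ₗ (T k).toFun ∘ₗ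
      (component k).toLinearMap.restrict _) u = _
    rw [LinearMap.sum_apply]
    rfl
  rw [this, map_sum]
  simp [component_inclusion]

/-- The operator `ℬ₂ = diag(𝒜₁, …, 𝒜_N)` on `L²(Ω; ℂᴺ)`. -/
def systemOperator (A : Fin N → EuclideanSpace ℝ (Fin d) → Matrix (Fin d) (Fin d) ℝ)
    (hA : ∀ k, IsBddMeas Ω (A k)) :
    L2 Ω (EuclideanSpace ℂ (Fin N)) →ₗ.[ℂ] L2 Ω (EuclideanSpace ℂ (Fin N)) :=
  diagOperator fun k => neumannOperator (A k) (hA k)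

/-- The operator `ℬ₂ + V` on `L²(Ω; ℂᴺ)`, whose domain is that of `ℬ₂`. -/
def coupledOperator (A : Fin N → EuclideanSpace ℝ (Fin d) → Matrix (Fin d) (Fin d) ℝ)
    (hA : ∀ k, IsBddMeas Ω (A k))
    (V : EuclideanSpace ℝ (Fin d) → Matrix (Fin N) (Fin N) ℂ) (hV : IsBddMeas Ω V) :
    L2 Ω (EuclideanSpace ℂ (Fin N)) →ₗ.[ℂ] L2 Ω (EuclideanSpace ℂ (Fin N)) :=
  mulOperator V hV +ᵥ systemOperator A hA

end System

end CoupledHeat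

end

/-! The proof is an energy argument. If `(ℬ₂ + V) u = iβ u`, take the real part of the inner product
with `u`. The term `iβ ‖u‖²` drops out, and `∑ₖ Re aₖ(uₖ, uₖ) = Re ⟪u, V u⟫ ≤ 0` by dissipativity
(`IsDissipative.re_inner_nonpos`, applied pointwise). By `ellipticForm_coercive` the left side is at
least `ν ∑ₖ ‖∇uₖ‖²`, so all gradients vanish. Since `Ω` is connected, `u` equals a constant vector
`c` almost everywhere. Moreover `ℬ₂ u = 0`, hence `V u = iβ u`, which says `V(x) c = iβ c` for
almost all `x`. This is `IsEigenvector.exists_const_and_mulOperator_eq`.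

Conversely, `Ω` is bounded, so constants lie in `L²`; they have weak gradient zero and are
annihilated by `ℬ₂`. A common kernel vector is therefore a constant eigenvector
(`isEigenvector_const`).

The analytic ingredient is that a vanishing weak gradient forces local constancy
(`exists_ae_eq_const_of_weakGradient_eq_zero`), which is shown by mollification. -/

namespace CoupledHeat

open Filter Metric
open scoped Topology Convolution

/-! ### Functions with vanishing weak gradient. -/

section ConstantFunctions

variable {d : ℕ}

/-- The test function `y ↦ φ (x - y)` obtained by reflecting and translating a normed bump
function whose support, moved to `x`, lies in `Ω`. -/
noncomputable def reflectedBump (Ω : TopologicalSpace.Opens (EuclideanSpace ℝ (Fin d)))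
    (φ : ContDiffBump (0 : EuclideanSpace ℝ (Fin d))) (x : EuclideanSpace ℝ (Fin d))
    (hx : closedBall x φ.rOut ⊆ Ω) : 𝓓(Ω, ℝ) where
  toFun y := φ.normed volume (x - y)
  contDiff' := φ.contDiff_normed.comp (contDiff_const.sub contDiff_id)
  hasCompactSupport' :=
    φ.hasCompactSupport_normed.comp_homeomorph (Homeomorph.subLeft x)
  tsupport_subset' := by
    refine (closure_minimal (fun y hy => ?_) isClosed_closedBall).trans hx
    have hy' : x - y ∈ tsupport (φ.normed volume) := subset_tsupport _ hy
    rw [φ.tsupport_normed_eq, mem_closedBall, dist_zero_right] at hy'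
    rwa [mem_closedBall', dist_eq_norm]

/-- The inner derivative of `y ↦ x - y` produces the sign. The identity turns the derivative of a
mollification at `x` into a pairing of `f` with a partial derivative of a test function on `Ω`. -/
theorem fderiv_reflectedBump (Ω : TopologicalSpace.Opens (EuclideanSpace ℝ (Fin d)))
    (φ : ContDiffBump (0 : EuclideanSpace ℝ (Fin d))) (x : EuclideanSpace ℝ (Fin d))
    (hx : closedBall x φ.rOut ⊆ Ω) (y v : EuclideanSpace ℝ (Fin d)) :
    fderiv ℝ (reflectedBump Ω φ x hx) y v = -fderiv ℝ (φ.normed volume) (x - y) v := by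
  have h1 : HasFDerivAt (φ.normed volume) (fderiv ℝ (φ.normed volume) (x - y)) (x - y) :=
    (φ.contDiff_normed (n := 1).differentiable one_ne_zero _).hasFDerivAt
  have h2 : HasFDerivAt (reflectedBump Ω φ x hx) _ y :=
    h1.comp y ((hasFDerivAt_id y).const_sub x)
  rw [h2.fderiv]
  simp

/-- A mollification of a function with vanishing weak gradient has derivative zero at all points
at a sufficient distance from the boundary. -/
theorem hasFDerivAt_convolution_of_weakGradient_eq_zero
    (Ω : TopologicalSpace.Opens (EuclideanSpace ℝ (Fin d)))
    {f : EuclideanSpace ℝ (Fin d) → ℂ} (hf : LocallyIntegrable f)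
    (h : ∀ (ψ : 𝓓(Ω, ℝ)) (i : Fin d),
      ∫ x, fderiv ℝ ψ x (EuclideanSpace.single i 1) • f x = 0)
    (φ : ContDiffBump (0 : EuclideanSpace ℝ (Fin d))) (x : EuclideanSpace ℝ (Fin d))
    (hx : closedBall x φ.rOut ⊆ Ω) :
    HasFDerivAt (φ.normed volume ⋆[ContinuousLinearMap.lsmul ℝ ℝ, volume] f)
      (0 : EuclideanSpace ℝ (Fin d) →L[ℝ] ℂ) x := by
  have hφ : ContDiff ℝ 1 (φ.normed (volume : Measure (EuclideanSpace ℝ (Fin d)))) :=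
    φ.contDiff_normed
  have hD := φ.hasCompactSupport_normed (μ := volume).hasFDerivAt_convolution_left
    (ContinuousLinearMap.lsmul ℝ ℝ) hφ hf x
  have hint : Integrable (fun t => (ContinuousLinearMap.lsmul ℝ ℝ).precompL
      (EuclideanSpace ℝ (Fin d)) (fderiv ℝ (φ.normed volume) (x - t)) (f t)) := by
    have := ((φ.hasCompactSupport_normed (μ := volume)).fderiv ℝ).convolutionExists_left
      ((ContinuousLinearMap.lsmul ℝ ℝ : ℝ →L[ℝ] ℂ →L[ℝ] ℂ).precompL (EuclideanSpace ℝ (Fin d)))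
      (hφ.continuous_fderiv one_ne_zero) hf x
    exact this.integrable_swap
  -- By `hD` the derivative of the convolution falls entirely on the smooth factor.
  suffices hz : (fderiv ℝ (φ.normed volume) ⋆[(ContinuousLinearMap.lsmul ℝ ℝ).precompL
      (EuclideanSpace ℝ (Fin d)), volume] f) x = 0 by rwa [hz] at hD
  rw [convolution_eq_swap]
  -- Coordinate directions suffice by linearity, and `h` speaks only of these; `hint` allows
  -- evaluation under the integral.
  refine ContinuousLinearMap.coe_injective
    ((EuclideanSpace.basisFun (Fin d) ℝ).toBasis.ext fun i => ?_)
  rw [ContinuousLinearMap.coe_coe, ContinuousLinearMap.integral_apply hint]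
  have := h (reflectedBump Ω φ x hx) i
  simp only [fderiv_reflectedBump, neg_smul, integral_neg, neg_eq_zero] at this
  simpa using this

/-- A function with vanishing weak gradient is almost everywhere constant on small balls. -/
theorem exists_ae_eq_const_ball
    (Ω : TopologicalSpace.Opens (EuclideanSpace ℝ (Fin d)))
    {f : EuclideanSpace ℝ (Fin d) → ℂ} (hf : LocallyIntegrable f)
    (h : ∀ (ψ : 𝓓(Ω, ℝ)) (i : Fin d),
      ∫ x, fderiv ℝ ψ x (EuclideanSpace.single i 1) • f x = 0)
    {x₀ : EuclideanSpace ℝ (Fin d)} (hx₀ : x₀ ∈ Ω) :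
    ∃ r > 0, ∃ c : ℂ, ∀ᵐ x, x ∈ ball x₀ r → f x = c := by
  obtain ⟨R, hR, hRΩ⟩ := Metric.isOpen_iff.1 Ω.isOpen x₀ hx₀
  -- Outer radii below `R / 2` keep the supports inside `Ω` when centred in `ball x₀ (R / 2)`; the
  -- shift by 2 makes this strict already for `n = 0`. The fixed ratio `rOut = 2 * rIn` is what
  -- almost everywhere convergence of the mollifications requires.
  let φ : ℕ → ContDiffBump (0 : EuclideanSpace ℝ (Fin d)) := fun n =>
    { rIn := R / 2 / (2 * (n + 2))
      rOut := R / 2 / (n + 2)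
      rIn_pos := by positivity
      rIn_lt_rOut := by
        apply div_lt_div_of_pos_left (by positivity) (by positivity)
        have : (0 : ℝ) ≤ n := n.cast_nonneg
        linarith }
  have hφout : ∀ n, (φ n).rOut = R / 2 / (n + 2) := fun n => rfl
  have hφlt : ∀ n, (φ n).rOut < R / 2 := fun n => by
    rw [hφout]
    refine div_lt_self (by positivity) ?_
    have : (0 : ℝ) ≤ n := n.cast_nonneg
    linarith
  have hlim : Tendsto (fun n => (φ n).rOut) atTop (𝓝 0) := by
    simp only [hφout]
    exact tendsto_const_nhds.div_atTop
      (tendsto_atTop_add_const_right _ _ tendsto_natCast_atTop_atTop)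
  have hconv := ContDiffBump.ae_convolution_tendsto_right_of_locallyIntegrable
    (μ := volume) (K := 2) (g := f) hlim (.of_forall fun n => le_of_eq (by
      change R / 2 / (n + 2) = 2 * (R / 2 / (2 * (n + 2)))
      field_simp)) hf
  have hsub : ∀ n, ∀ x ∈ ball x₀ (R / 2), closedBall x (φ n).rOut ⊆ Ω := fun n x hx =>
    (closedBall_subset_ball' (by rw [mem_ball] at hx; linarith [hφlt n])).trans hRΩ
  have hconst : ∀ n, ∀ x ∈ ball x₀ (R / 2), ∀ y ∈ ball x₀ (R / 2),
      ((φ n).normed volume ⋆[ContinuousLinearMap.lsmul ℝ ℝ, volume] f) x =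
        ((φ n).normed volume ⋆[ContinuousLinearMap.lsmul ℝ ℝ, volume] f) y := by
    intro n x hx y hy
    have hd := fun z hz =>
      hasFDerivAt_convolution_of_weakGradient_eq_zero Ω hf h (φ n) z (hsub n z hz)
    exact isOpen_ball.is_const_of_fderiv_eq_zero (𝕜 := ℝ) (convex_ball x₀ (R / 2)).isPreconnected
      (fun z hz => (hd z hz).differentiableAt.differentiableWithinAt)
      (fun z hz => (hd z hz).fderiv) hx hy
  -- The ball has positive measure, so it contains a point of convergence. The value of `f` there
  -- serves as the constant, because each mollification is constant on the ball.
  obtain ⟨y, hy, hyc⟩ : ∃ y ∈ ball x₀ (R / 2), Tendsto (fun n =>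
      ((φ n).normed volume ⋆[ContinuousLinearMap.lsmul ℝ ℝ, volume] f) y) atTop (𝓝 (f y)) := by
    by_contra! hcon
    refine (measure_ball_pos volume x₀ (half_pos hR)).ne' (measure_mono_null ?_ hconv)
    exact fun y hy => hcon y hy
  refine ⟨R / 2, half_pos hR, f y, ?_⟩
  filter_upwards [hconv] with x hxc hx
  exact tendsto_nhds_unique hxc (hyc.congr fun n => hconst n y hy x hx)

/-- A function with vanishing weak gradient on a connected open set is almost everywhere
constant. -/
theorem exists_ae_eq_const_of_weakGradient_eq_zero
    (Ω : TopologicalSpace.Opens (EuclideanSpace ℝ (Fin d)))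
    (hΩ : IsPreconnected (Ω : Set (EuclideanSpace ℝ (Fin d))))
    {f : EuclideanSpace ℝ (Fin d) → ℂ} (hf : LocallyIntegrable f)
    (h : ∀ (ψ : 𝓓(Ω, ℝ)) (i : Fin d),
      ∫ x, fderiv ℝ ψ x (EuclideanSpace.single i 1) • f x = 0) :
    ∃ c : ℂ, ∀ᵐ x ∂(volume.restrict (Ω : Set (EuclideanSpace ℝ (Fin d)))), f x = c := by
  have hloc := fun x : Ω => exists_ae_eq_const_ball Ω hf h x.2
  choose r hr c hc using hloc
  have : PreconnectedSpace Ω := isPreconnected_iff_preconnectedSpace.1 hΩ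
  have hlc : IsLocallyConstant c := by
    -- For `y` near `x` the two balls overlap in a nonempty open set, which has positive measure. If
    -- the constants differed, no point of the overlap could satisfy both almost everywhere
    -- identities.
    refine (IsLocallyConstant.iff_eventually_eq c).2 fun x => ?_
    filter_upwards [continuous_subtype_val.continuousAt.preimage_mem_nhds
      (ball_mem_nhds (x : EuclideanSpace ℝ (Fin d)) (hr x))] with y hy
    have hne : (ball (y : EuclideanSpace ℝ (Fin d)) (r y) ∩ ball (x : EuclideanSpace ℝ (Fin d))
      (r x)).Nonempty := ⟨y, mem_ball_self (hr y), hy⟩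
    by_contra hcon
    refine ((isOpen_ball.inter isOpen_ball).measure_pos volume hne).ne' (measure_mono_null ?_
      (ae_iff.1 ((hc x).and (hc y))))
    rintro z ⟨hzy, hzx⟩ ⟨h1, h2⟩
    exact hcon ((h2 hzy).symm.trans (h1 hzx))
  obtain ⟨c₀, hc₀⟩ := hlc.exists_eq_const
  refine ⟨c₀, (ae_restrict_iff' Ω.isOpen.measurableSet).2 (ae_iff.2 ?_)⟩
  -- The exceptional set is null near each of its points, hence null; this avoids choosing a
  -- countable cover by hand.
  refine measure_null_of_locally_null _ fun x hx => ?_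
  simp only [Set.mem_ofPred_eq, Classical.not_imp] at hx
  refine ⟨_, inter_mem_nhdsWithin _ (ball_mem_nhds x (hr ⟨x, hx.1⟩)), measure_mono_null ?_
    (ae_iff.1 (hc ⟨x, hx.1⟩))⟩
  rintro z ⟨hz, hzx⟩ hcz
  refine hz fun _ => ?_
  rw [hcz hzx, hc₀]
  rfl

end ConstantFunctions

end CoupledHeat

namespace CoupledHeat

/-! ### Energy estimates, constant functions and componentwise description of the operators. -/

section Energy

/-- Squaring the dissipativity estimate and expanding gives `2 μ Re ⟪x, T x⟫ ≤ ‖T x‖²` for all `μ >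
0`, which is impossible for large `μ` if the real part is positive. -/
theorem IsDissipative.re_inner_nonpos {F : Type*} [NormedAddCommGroup F] [InnerProductSpace ℂ F]
    {T : F →ₗ[ℂ] F} (hT : IsDissipative T) (x : F) : (⟪x, T x⟫_ℂ).re ≤ 0 := by
  have key : ∀ μ : ℝ, 0 < μ → 2 * μ * (⟪x, T x⟫_ℂ).re ≤ ‖T x‖ ^ 2 := fun μ hμ => by
    have h := pow_le_pow_left₀ (by positivity) (hT μ hμ x) 2
    rw [norm_sub_sq (𝕜 := ℂ), inner_smul_left, norm_smul] at h
    simp only [Complex.conj_ofReal, Complex.norm_real, Real.norm_eq_abs, abs_of_pos hμ,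
      RCLike.re_to_complex, Complex.re_ofReal_mul] at h
    linarith
  by_contra! hpos
  -- This `μ` makes the left side of `key` equal to `‖T x‖ ^ 2 + 1`.
  have := key ((‖T x‖ ^ 2 + 1) / (2 * (⟪x, T x⟫_ℂ).re)) (by positivity)
  have e : 2 * ((‖T x‖ ^ 2 + 1) / (2 * (⟪x, T x⟫_ℂ).re)) * (⟪x, T x⟫_ℂ).re = ‖T x‖ ^ 2 + 1 := by
    field_simp
  linarith

theorem re_inner_self {F : Type*} [NormedAddCommGroup F] [InnerProductSpace ℂ F] (x : F) :
    (⟪x, x⟫_ℂ).re = ‖x‖ ^ 2 :=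
  inner_self_eq_norm_sq (𝕜 := ℂ) x

theorem re_I_mul_inner_self {F : Type*} [NormedAddCommGroup F] [InnerProductSpace ℂ F] (β : ℝ)
    (x : F) : (Complex.I * β * ⟪x, x⟫_ℂ).re = 0 := by
  have h : (⟪x, x⟫_ℂ).im = 0 := inner_self_im (𝕜 := ℂ) x
  rw [mul_assoc, Complex.I_mul_re, Complex.im_ofReal_mul, h, mul_zero, neg_zero]

/-- Transfers pointwise inequalities to `L²`; both the dissipativity of `V` and the coercivity of
the forms pass through it. -/
theorem re_inner_nonneg_of_ae {α F : Type*} [MeasurableSpace α] {μ : Measure α}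
    [NormedAddCommGroup F] [InnerProductSpace ℂ F] {f g : Lp F 2 μ}
    (h : ∀ᵐ x ∂μ, 0 ≤ (⟪f x, g x⟫_ℂ).re) : 0 ≤ (⟪f, g⟫_ℂ).re := by
  have e : (⟪f, g⟫_ℂ).re = ∫ x, (⟪f x, g x⟫_ℂ).re ∂μ := by
    rw [L2.inner_def]
    exact (integral_re (L2.integrable_inner (𝕜 := ℂ) f g)).symm
  rw [e]
  exact integral_nonneg_of_ae h

variable {d N : ℕ} {Ω : TopologicalSpace.Opens (EuclideanSpace ℝ (Fin d))}

theorem formIntegrand_eq_inner (A : Matrix (Fin d) (Fin d) ℝ) (ξ η : EuclideanSpace ℂ (Fin d)) :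
    formIntegrand A ξ η = ⟪η, (A.transpose.map Complex.ofReal).toEuclideanLin ξ⟫_ℂ := by
  rw [formIntegrand, Finset.sum_comm]
  simp only [PiLp.inner_apply, RCLike.inner_apply, Matrix.toLpLin_apply, Matrix.mulVec, dotProduct,
    Finset.sum_mul, Matrix.map_apply, Matrix.transpose_apply]
  refine Finset.sum_congr rfl fun j _ => Finset.sum_congr rfl fun i _ => ?_
  ring

theorem coeFn_mulOperator {n : ℕ} {M : EuclideanSpace ℝ (Fin d) → Matrix (Fin n) (Fin n) ℂ}
    (hM : IsBddMeas Ω M) (u : L2 Ω (EuclideanSpace ℂ (Fin n))) :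
    ∀ᵐ x ∂(volume.restrict (Ω : Set (EuclideanSpace ℝ (Fin d)))),
      mulOperator M hM u x = (M x).toEuclideanLin (u x) :=
  (hM.memLp u).coeFn_toLp

theorem re_inner_mulOperator_nonpos {n : ℕ}
    {M : EuclideanSpace ℝ (Fin d) → Matrix (Fin n) (Fin n) ℂ} (hM : IsBddMeas Ω M)
    (hdiss : ∀ᵐ x ∂(volume.restrict (Ω : Set (EuclideanSpace ℝ (Fin d)))),
      IsDissipative (M x).toEuclideanLin) (u : L2 Ω (EuclideanSpace ℂ (Fin n))) :
    (⟪u, mulOperator M hM u⟫_ℂ).re ≤ 0 := by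
  rw [← neg_nonneg, ← Complex.neg_re, ← inner_neg_right]
  refine re_inner_nonneg_of_ae ?_
  filter_upwards [hdiss, coeFn_mulOperator hM u, Lp.coeFn_neg (mulOperator M hM u)]
    with x hd hx hn
  rw [hn, Pi.neg_apply, hx, inner_neg_right, Complex.neg_re, neg_nonneg]
  exact hd.re_inner_nonpos _

theorem ellipticForm_apply {A : EuclideanSpace ℝ (Fin d) → Matrix (Fin d) (Fin d) ℝ}
    (hA : IsBddMeas Ω A) (u v : H1 Ω) :
    ellipticForm A hA u v =
      ⟪weakGradient Ω v, mulOperator _ hA.transpose_map (weakGradient Ω u)⟫_ℂ :=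
  integral_formIntegrand hA _ _

theorem ellipticForm_coercive {A : EuclideanSpace ℝ (Fin d) → Matrix (Fin d) (Fin d) ℝ}
    (hA : IsBddMeas Ω A) {ν : ℝ}
    (hν : ∀ᵐ x ∂(volume.restrict (Ω : Set (EuclideanSpace ℝ (Fin d)))),
      ∀ ξ : EuclideanSpace ℂ (Fin d), ν * ‖ξ‖ ^ 2 ≤ (formIntegrand (A x) ξ ξ).re) (u : H1 Ω) :
    ν * ‖weakGradient Ω u‖ ^ 2 ≤ (ellipticForm A hA u u).re := by
  rw [ellipticForm_apply]
  set G := weakGradient Ω u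
  -- Pointwise coercivity is nonnegativity of `Re ⟪G, Aᵀ G - ν G⟫`, which can be integrated.
  have h : 0 ≤ (⟪G, mulOperator _ hA.transpose_map G - (ν : ℂ) • G⟫_ℂ).re := by
    refine re_inner_nonneg_of_ae ?_
    filter_upwards [hν, coeFn_mulOperator hA.transpose_map G,
      Lp.coeFn_sub (mulOperator _ hA.transpose_map G) ((ν : ℂ) • G), Lp.coeFn_smul (ν : ℂ) G]
      with x h1 h2 h3 h4
    have := h1 (G x)
    rw [formIntegrand_eq_inner] at this
    rw [h3, Pi.sub_apply, h4, h2, Pi.smul_apply, inner_sub_right, inner_smul_right,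
      Complex.sub_re, Complex.re_ofReal_mul, re_inner_self]
    linarith
  rw [inner_sub_right, inner_smul_right, Complex.sub_re,
    Complex.re_ofReal_mul, re_inner_self] at h
  linarith

theorem weakGradient_mem_graph (u : H1 Ω) :
    ((u : L2 Ω ℂ), weakGradient Ω u) ∈ weakGradientGraph Ω :=
  weakGradient_graph Ω ▸ (weakGradient Ω).mem_graph u

theorem integral_smul_zero_apply (φ : EuclideanSpace ℝ (Fin d) → ℝ) (i : Fin d) :
    ∫ x in Ω, φ x • (0 : L2 Ω (EuclideanSpace ℂ (Fin d))) x i = 0 := by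
  refine integral_eq_zero_of_ae ?_
  filter_upwards [Lp.coeFn_zero (EuclideanSpace ℂ (Fin d)) 2
    (volume.restrict (Ω : Set (EuclideanSpace ℝ (Fin d))))] with x hx
  simp only [hx, Pi.zero_apply, PiLp.zero_apply, smul_zero]

/-- A function in `H¹(Ω; ℂ)` with vanishing gradient on a connected set is constant. -/
theorem exists_ae_eq_const_of_weakGradient_apply_eq_zero
    (hΩ : IsPreconnected (Ω : Set (EuclideanSpace ℝ (Fin d)))) (u : H1 Ω)
    (hu : weakGradient Ω u = 0) :
    ∃ c : ℂ, ∀ᵐ x ∂(volume.restrict (Ω : Set (EuclideanSpace ℝ (Fin d)))),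
      (u : L2 Ω ℂ) x = c := by
  have hΩm := Ω.isOpen.measurableSet
  -- Mollification needs a function on the whole space, so `u` is extended by zero; pairings with
  -- test functions on `Ω` do not change.
  have hloc : LocallyIntegrable
      ((Ω : Set (EuclideanSpace ℝ (Fin d))).indicator (u : L2 Ω ℂ)) :=
    ((memLp_indicator_iff_restrict hΩm).2 (Lp.memLp (u : L2 Ω ℂ))).locallyIntegrable (by norm_num)
  obtain ⟨c, hc⟩ := exists_ae_eq_const_of_weakGradient_eq_zero Ω hΩ hloc fun ψ i => by
    have h : ∫ x in Ω, fderiv ℝ ψ x (EuclideanSpace.single i 1) • (u : L2 Ω ℂ) x =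
        -∫ x in Ω, ψ x • weakGradient Ω u x i := weakGradient_mem_graph u ψ i
    rw [hu] at h
    rw [integral_smul_zero_apply, neg_zero, ← integral_indicator hΩm] at h
    rw [← h]
    refine integral_congr_ae (.of_forall fun x => ?_)
    exact (Set.indicator_smul_apply _ (fun x => fderiv ℝ ψ x (EuclideanSpace.single i 1))
      (u : L2 Ω ℂ) x).symm
  refine ⟨c, ?_⟩
  filter_upwards [hc, ae_restrict_mem hΩm] with x hx hxΩ
  rwa [Set.indicator_of_mem hxΩ] at hx

theorem integral_fderiv_testFunction (φ : 𝓓(Ω, ℝ)) (v : EuclideanSpace ℝ (Fin d)) :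
    ∫ x in Ω, fderiv ℝ φ x v = 0 := by
  have hint : Integrable (fun x => fderiv ℝ φ x v) :=
    (φ.continuous_partial Ω v).integrable_of_hasCompactSupport (φ.hasCompactSupport_partial Ω v)
  have hφ : Integrable φ := φ.continuous.integrable_of_hasCompactSupport φ.hasCompactSupport
  rw [setIntegral_eq_integral_of_forall_compl_eq_zero fun x hx => by
    have h0 : fderiv ℝ φ x = 0 := by
      by_contra hne
      exact hx (φ.tsupport_subset (support_fderiv_subset ℝ hne))
    rw [h0, zero_apply]]
  -- Integration by parts against the constant function 1.
  have := integral_mul_fderiv_eq_neg_fderiv_mul_of_integrable (μ := volume)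
    (f := fun _ : EuclideanSpace ℝ (Fin d) => (1 : ℝ)) (g := φ) (v := v) (by simp)
    (by simpa using hint) (by simpa using hφ) (fun x _ => by fun_prop)
    (fun x _ => φ.contDiff.differentiable (by simp) x)
  simpa using this

/-- Constant functions on a set of finite measure have weak gradient zero. -/
theorem const_mem_weakGradientGraph
    [IsFiniteMeasure (volume.restrict (Ω : Set (EuclideanSpace ℝ (Fin d))))] (c : ℂ) :
    (Lp.const 2 _ c, 0) ∈ weakGradientGraph Ω := by
  intro φ i
  have h1 : ∫ x in Ω, fderiv ℝ φ x (EuclideanSpace.single i 1) • (Lp.const 2 _ c : L2 Ω ℂ) x =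
      ∫ x in Ω, fderiv ℝ φ x (EuclideanSpace.single i 1) • c := by
    refine integral_congr_ae ?_
    filter_upwards [Lp.coeFn_const 2 (volume.restrict (Ω : Set (EuclideanSpace ℝ (Fin d)))) c]
      with x hx
    rw [hx, Function.const_apply]
  change ∫ x in Ω, fderiv ℝ φ x (EuclideanSpace.single i 1) • (Lp.const 2 _ c : L2 Ω ℂ) x =
    -∫ x in Ω, φ x • (0 : L2 Ω (EuclideanSpace ℂ (Fin d))) x i
  rw [integral_smul_zero_apply, h1, integral_smul_const, integral_fderiv_testFunction, zero_smul, neg_zero]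

theorem exists_weakGradient_const
    [IsFiniteMeasure (volume.restrict (Ω : Set (EuclideanSpace ℝ (Fin d))))] (c : ℂ) :
    ∃ w : H1 Ω, (w : L2 Ω ℂ) = Lp.const 2 _ c ∧ weakGradient Ω w = 0 := by
  have h := const_mem_weakGradientGraph (Ω := Ω) c
  rw [← weakGradient_graph, LinearPMap.mem_graph_iff] at h
  exact h

/-- Recovers the weak formulation from the abstract operator. Density of `H¹` ensures that the graph
of the induced operator is the full form graph; the sign arises because `-𝒜` is the operator induced
by the form. -/
theorem neumannOperator_apply_eq_iff {A : EuclideanSpace ℝ (Fin d) → Matrix (Fin d) (Fin d) ℝ}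
    (hA : IsBddMeas Ω A) {u f : L2 Ω ℂ} :
    (∃ hu : u ∈ (neumannOperator A hA).domain, neumannOperator A hA ⟨u, hu⟩ = f) ↔
      ∃ w : H1 Ω, (w : L2 Ω ℂ) = u ∧ ∀ v : H1 Ω, ellipticForm A hA w v = -⟪(v : L2 Ω ℂ), f⟫_ℂ := by
  have h : (u, -f) ∈ (formOperator (H1 Ω) (ellipticForm A hA)).graph ↔
      (u, -f) ∈ formGraph (H1 Ω) (ellipticForm A hA) := by
    rw [formOperator_graph _ (dense_H1 Ω)]
  rw [LinearPMap.mem_graph_iff] at h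
  refine Iff.trans ⟨?_, ?_⟩ (h.trans ⟨?_, ?_⟩)
  · rintro ⟨hu, rfl⟩
    exact ⟨⟨u, hu⟩, rfl, (neg_neg _).symm⟩
  · rintro ⟨⟨y, hy⟩, rfl, hyf⟩
    exact ⟨hy, (congrArg Neg.neg hyf).trans (neg_neg f)⟩
  · rintro ⟨w, hw, hwv⟩
    exact ⟨w, hw, fun v => (hwv v).trans (inner_neg_right _ _)⟩
  · rintro ⟨w, hw, hwv⟩
    exact ⟨w, hw, fun v => (hwv v).trans (inner_neg_right _ _).symm⟩

theorem coeFn_component (k : Fin N) (u : L2 Ω (EuclideanSpace ℂ (Fin N))) :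
    ∀ᵐ x ∂(volume.restrict (Ω : Set (EuclideanSpace ℝ (Fin d)))), component k u x = u x k :=
  (EuclideanSpace.proj k : EuclideanSpace ℂ (Fin N) →L[ℂ] ℂ).coeFn_compLp u

theorem ext_component {u w : L2 Ω (EuclideanSpace ℂ (Fin N))}
    (h : ∀ k, component k u = component k w) : u = w := by
  refine Lp.ext ?_
  filter_upwards [ae_all_iff.2 fun k => coeFn_component k u,
    ae_all_iff.2 fun k => coeFn_component k w] with x hu hw
  ext k
  rw [← hu, ← hw, h]

theorem inner_eq_sum_component (u w : L2 Ω (EuclideanSpace ℂ (Fin N))) :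
    ⟪u, w⟫_ℂ = ∑ k, ⟪component k u, component k w⟫_ℂ := by
  simp only [L2.inner_def]
  rw [← integral_finsetSum _ fun k _ => L2.integrable_inner (component k u) (component k w)]
  refine integral_congr_ae ?_
  filter_upwards [ae_all_iff.2 fun k => coeFn_component k u,
    ae_all_iff.2 fun k => coeFn_component k w] with x hu hw
  simp only [PiLp.inner_apply, hu, hw]

theorem component_const
    [IsFiniteMeasure (volume.restrict (Ω : Set (EuclideanSpace ℝ (Fin d))))] (k : Fin N)
    (c : EuclideanSpace ℂ (Fin N)) :
    component k (Lp.const 2 _ c : L2 Ω (EuclideanSpace ℂ (Fin N))) = Lp.const 2 _ (c k) := by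
  refine Lp.ext ?_
  filter_upwards [coeFn_component k (Lp.const 2 _ c : L2 Ω (EuclideanSpace ℂ (Fin N))),
    Lp.coeFn_const 2 (volume.restrict (Ω : Set (EuclideanSpace ℝ (Fin d)))) c,
    Lp.coeFn_const 2 (volume.restrict (Ω : Set (EuclideanSpace ℝ (Fin d)))) (c k)] with x h1 h2 h3
  rw [h1, h2, h3]
  rfl

end Energy

/-! ### Eigenvectors for imaginary eigenvalues and constant eigenvectors. -/

section Eigenvectors

variable {d N : ℕ} {Ω : TopologicalSpace.Opens (EuclideanSpace ℝ (Fin d))}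

/-- Eigenvectors of the coupled operator for imaginary eigenvalues are constant functions, and
they are eigenvectors of the multiplication operator. -/
theorem IsEigenvector.exists_const_and_mulOperator_eq
    (hΩ : IsPreconnected (Ω : Set (EuclideanSpace ℝ (Fin d))))
    {A : Fin N → EuclideanSpace ℝ (Fin d) → Matrix (Fin d) (Fin d) ℝ}
    (hA : ∀ k, IsBddMeas Ω (A k)) {ν : ℝ} (hν : 0 < ν)
    (hAν : ∀ k, ∀ᵐ x ∂(volume.restrict (Ω : Set (EuclideanSpace ℝ (Fin d)))),
      ∀ ξ : EuclideanSpace ℂ (Fin d), ν * ‖ξ‖ ^ 2 ≤ (formIntegrand (A k x) ξ ξ).re)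
    {V : EuclideanSpace ℝ (Fin d) → Matrix (Fin N) (Fin N) ℂ} (hV : IsBddMeas Ω V)
    (hdiss : ∀ᵐ x ∂(volume.restrict (Ω : Set (EuclideanSpace ℝ (Fin d)))),
      IsDissipative (V x).toEuclideanLin)
    {β : ℝ} {u : L2 Ω (EuclideanSpace ℂ (Fin N))}
    (hu : IsEigenvector (coupledOperator A hA V hV) (Complex.I * β) u) :
    (∃ c : EuclideanSpace ℂ (Fin N),
      ∀ᵐ x ∂(volume.restrict (Ω : Set (EuclideanSpace ℝ (Fin d)))), u x = c) ∧
    mulOperator V hV u = (Complex.I * β) • u := by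
  obtain ⟨-, hdom, heq⟩ := hu
  set g := systemOperator A hA ⟨u, hdom⟩
  have heq' : mulOperator V hV u + g = (Complex.I * β) • u := heq
  have hcomp : ∀ k, ∃ w : H1 Ω, (w : L2 Ω ℂ) = component k u ∧
      ∀ v : H1 Ω, ellipticForm (A k) (hA k) w v = -⟪(v : L2 Ω ℂ), component k g⟫_ℂ := fun k =>
    (neumannOperator_apply_eq_iff (hA k)).1
      ⟨_, (component_diagOperator (fun k => neumannOperator (A k) (hA k)) ⟨u, hdom⟩ k).symm⟩
  choose w hw hwv using hcomp
  -- The real part of the eigenvalue equation tested with `u`: `⟪u, g⟫` is minus the sum of the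
  -- forms, and `iβ ‖u‖²` is purely imaginary.
  have hsum : ∑ k, (ellipticForm (A k) (hA k) (w k) (w k)).re ≤ 0 := by
    have e : ∑ k, (ellipticForm (A k) (hA k) (w k) (w k)).re =
        (⟪u, mulOperator V hV u⟫_ℂ).re := by
      have e1 : mulOperator V hV u = (Complex.I * β) • u - g := eq_sub_of_add_eq heq'
      rw [e1, inner_sub_right, inner_smul_right,
        inner_eq_sum_component u g, ← Complex.re_sum]
      simp only [hwv, hw, Finset.sum_neg_distrib, Complex.sub_re, Complex.neg_re]
      rw [re_I_mul_inner_self, zero_sub]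
    rw [e]
    exact re_inner_mulOperator_nonpos hV hdiss u
  have hgrad : ∀ k, weakGradient Ω (w k) = 0 := fun k => by
    have hk := fun k => ellipticForm_coercive (hA k) (hAν k) (w k)
    have h0 : ∀ k, 0 ≤ (ellipticForm (A k) (hA k) (w k) (w k)).re := fun k =>
      le_trans (by positivity) (hk k)
    -- Nonnegative summands with nonpositive sum are each nonpositive, so coercivity annihilates
    -- every gradient.
    have hle := (Finset.single_le_sum (fun k _ => h0 k) (Finset.mem_univ k)).trans hsum
    have hn : ‖weakGradient Ω (w k)‖ ^ 2 ≤ 0 :=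
      nonpos_of_mul_nonpos_right ((hk k).trans hle) hν
    exact norm_eq_zero.1 (pow_eq_zero_iff two_ne_zero |>.1 (le_antisymm hn (sq_nonneg _)))
  refine ⟨?_, ?_⟩
  · choose c hc using fun k => exists_ae_eq_const_of_weakGradient_apply_eq_zero hΩ (w k) (hgrad k)
    refine ⟨WithLp.toLp 2 c, ?_⟩
    filter_upwards [ae_all_iff.2 hc, ae_all_iff.2 fun k => coeFn_component k u] with x h1 h2
    ext k
    rw [← h2, ← hw, h1]
  -- With zero gradient the form vanishes against every `v`, so each component of `g` is orthogonal
  -- to the dense subspace `H¹`.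
  · have hg0 : g = 0 := ext_component fun k => by
      rw [map_zero]
      refine (dense_H1 Ω).eq_zero_of_inner_right (𝕜 := ℂ) fun v hv => ?_
      have := hwv k ⟨v, hv⟩
      rwa [ellipticForm_apply, hgrad, map_zero, inner_zero_right, eq_comm, neg_eq_zero] at this
    rwa [hg0, add_zero] at heq'

/-- A nonzero vector that is an eigenvector of almost all matrices `V x` gives a constant
eigenvector of the coupled operator. -/
theorem isEigenvector_const (hne : (Ω : Set (EuclideanSpace ℝ (Fin d))).Nonempty)
    [IsFiniteMeasure (volume.restrict (Ω : Set (EuclideanSpace ℝ (Fin d))))]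
    {A : Fin N → EuclideanSpace ℝ (Fin d) → Matrix (Fin d) (Fin d) ℝ}
    (hA : ∀ k, IsBddMeas Ω (A k))
    {V : EuclideanSpace ℝ (Fin d) → Matrix (Fin N) (Fin N) ℂ} (hV : IsBddMeas Ω V)
    {μ : ℂ} {c : EuclideanSpace ℂ (Fin N)} (hc : c ≠ 0)
    (hVc : ∀ᵐ x ∂(volume.restrict (Ω : Set (EuclideanSpace ℝ (Fin d)))),
      (V x).toEuclideanLin c = μ • c) :
    IsEigenvector (coupledOperator A hA V hV) μ (Lp.const 2 _ c) := by
  have hconst := Lp.coeFn_const 2 (volume.restrict (Ω : Set (EuclideanSpace ℝ (Fin d)))) c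
  have hcomp : ∀ k, ∃ h : component k (Lp.const 2 _ c : L2 Ω (EuclideanSpace ℂ (Fin N))) ∈
      (neumannOperator (A k) (hA k)).domain, neumannOperator (A k) (hA k) ⟨_, h⟩ = 0 := fun k => by
    rw [neumannOperator_apply_eq_iff]
    obtain ⟨w, hw, hw0⟩ := exists_weakGradient_const (Ω := Ω) (c k)
    refine ⟨w, hw.trans (component_const k c).symm, fun v => ?_⟩
    rw [ellipticForm_apply, hw0, map_zero, inner_zero_right, inner_zero_right, neg_zero]
  have hdom : (Lp.const 2 _ c : L2 Ω (EuclideanSpace ℂ (Fin N))) ∈ (systemOperator A hA).domain :=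
    (Submodule.mem_iInf _).2 fun k => (hcomp k).1
  refine ⟨fun h0 => ?_, hdom, ?_⟩
  -- A nonzero constant could vanish in `L²` only if the nonempty open set `Ω` were null.
  · refine (Ω.isOpen.measure_pos volume hne).ne' ?_
    rw [← Measure.restrict_eq_zero, ← ae_eq_bot, ← Filter.eventually_false_iff_eq_bot]
    filter_upwards [hconst, (Lp.eq_zero_iff_ae_eq_zero.1 h0)] with x h1 h2
    exact hc (h1.symm.trans h2)
  · have hsys : systemOperator A hA ⟨_, hdom⟩ = 0 := ext_component fun k => by
      rw [map_zero]
      exact (component_diagOperator _ ⟨_, hdom⟩ k).trans (hcomp k).2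
    change mulOperator V hV (Lp.const 2 _ c) + systemOperator A hA ⟨_, hdom⟩ = _
    rw [hsys, add_zero]
    refine Lp.ext ?_
    filter_upwards [hconst, hVc, coeFn_mulOperator hV (Lp.const 2 _ c),
      Lp.coeFn_smul μ (Lp.const 2 _ c : L2 Ω (EuclideanSpace ℂ (Fin N)))] with x h1 h2 h3 h4
    rw [h3, h4, Pi.smul_apply, h1, Function.const_apply, h2]

/-- Provides the measurable set of full measure in assertion (ii). The entries of `V` are measurable
on the subtype `Ω` only, so the set is formed there and mapped into the ambient space, where `Ω` is
measurable. -/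
theorem measurableSet_toEuclideanLin_eq
    {V : EuclideanSpace ℝ (Fin d) → Matrix (Fin N) (Fin N) ℂ} (hV : IsBddMeas Ω V)
    (c b : EuclideanSpace ℂ (Fin N)) :
    MeasurableSet {x | x ∈ Ω ∧ (V x).toEuclideanLin c = b} := by
  have h : MeasurableSet {x : Ω | ∀ i, ∑ j, V x i j * c j = b i} := by
    simp only [Set.ofPred_forall]
    exact .iInter fun i => measurableSet_eq_fun
      (Finset.measurable_sum _ fun j _ => (hV.measurable i j).mul_const _) measurable_const
  convert Ω.isOpen.measurableSet.subtype_image h using 1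
  have hiff : ∀ x, (V x).toEuclideanLin c = b ↔ ∀ i, ∑ j, V x i j * c j = b i := fun x => by
    simp only [PiLp.ext_iff, Matrix.toLpLin_apply, Matrix.mulVec, dotProduct]
  ext x
  simp only [hiff]
  exact ⟨fun h => ⟨⟨x, h.1⟩, h.2, rfl⟩, fun ⟨y, h, hyx⟩ => hyx ▸ ⟨y.2, h⟩⟩

theorem mem_iInf_ker_iff {s : Set (EuclideanSpace ℝ (Fin d))} {μ : ℂ}
    {V : EuclideanSpace ℝ (Fin d) → Matrix (Fin N) (Fin N) ℂ} {c : EuclideanSpace ℂ (Fin N)} :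
    c ∈ (⨅ x ∈ s, LinearMap.ker (μ • LinearMap.id - (V x).toEuclideanLin)) ↔
      ∀ x ∈ s, (V x).toEuclideanLin c = μ • c := by
  simp only [Submodule.mem_iInf, LinearMap.mem_ker, LinearMap.sub_apply, LinearMap.smul_apply,
    LinearMap.id_apply, sub_eq_zero]
  exact forall₂_congr fun x _ => eq_comm

end Eigenvectors

end CoupledHeat

/-! ### The equivalence and the constancy of eigenvectors. -/

theorem proposition3p4 {d N : ℕ} (hN : 1 ≤ N)
    (Ω : TopologicalSpace.Opens (EuclideanSpace ℝ (Fin d)))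
    (hΩ_conn : IsConnected (Ω : Set (EuclideanSpace ℝ (Fin d))))
    (hΩ_bdd : Bornology.IsBounded (Ω : Set (EuclideanSpace ℝ (Fin d))))
    (hΩ_ext : CoupledHeat.HasExtensionProperty Ω)
    (A : Fin N → EuclideanSpace ℝ (Fin d) → Matrix (Fin d) (Fin d) ℝ)
    (hA : ∀ k, CoupledHeat.IsBddMeas Ω (A k))
    (hA_coercive : ∃ ν : ℝ, 0 < ν ∧ ∀ k,
      ∀ᵐ x ∂(volume.restrict (Ω : Set (EuclideanSpace ℝ (Fin d)))),
        ∀ ξ : EuclideanSpace ℂ (Fin d),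
          ν * ‖ξ‖ ^ 2 ≤ (CoupledHeat.formIntegrand (A k x) ξ ξ).re)
    (V : EuclideanSpace ℝ (Fin d) → Matrix (Fin N) (Fin N) ℂ)
    (hV : CoupledHeat.IsBddMeas Ω V)
    (hV_diss : ∀ᵐ x ∂(volume.restrict (Ω : Set (EuclideanSpace ℝ (Fin d)))),
      CoupledHeat.IsDissipative (V x).toEuclideanLin)
    (β : ℝ) :
    (Complex.I * β ∈ CoupledHeat.pointSpectrum (CoupledHeat.coupledOperator A hA V hV) ↔
      ∃ Ω' : Set (EuclideanSpace ℝ (Fin d)), Ω' ⊆ Ω ∧ MeasurableSet Ω' ∧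
        volume ((Ω : Set (EuclideanSpace ℝ (Fin d))) \ Ω') = 0 ∧
        (⨅ x ∈ Ω', LinearMap.ker ((Complex.I * β) • LinearMap.id - (V x).toEuclideanLin)) ≠ ⊥) ∧
    ∀ u : CoupledHeat.L2 Ω (EuclideanSpace ℂ (Fin N)),
      CoupledHeat.IsEigenvector (CoupledHeat.coupledOperator A hA V hV) (Complex.I * β) u →
      ∀ k : Fin N, ∃ c : ℂ,
        ∀ᵐ x ∂(volume.restrict (Ω : Set (EuclideanSpace ℝ (Fin d)))), u x k = c := by
  obtain ⟨ν, hν, hAν⟩ := hA_coercive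
  have hfin : IsFiniteMeasure (volume.restrict (Ω : Set (EuclideanSpace ℝ (Fin d)))) :=
    ⟨by simpa using hΩ_bdd.measure_lt_top⟩
  have hconst := fun u hu => CoupledHeat.IsEigenvector.exists_const_and_mulOperator_eq (u := u)
    (β := β) hΩ_conn.isPreconnected hA hν hAν hV hV_diss hu
  refine ⟨⟨?_, ?_⟩, fun u hu k => ?_⟩
  · rintro ⟨u, hu⟩
    obtain ⟨⟨c, hc⟩, hVu⟩ := hconst u hu
    -- The set of all points where the constant value `c` of `u` solves the matrix eigenvalue
    -- equation; `c` then lies in the intersection of kernels by construction, and only full measure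
    -- has to be checked.
    refine ⟨{x | x ∈ Ω ∧ (V x).toEuclideanLin c = (Complex.I * β) • c}, fun x hx => hx.1,
      CoupledHeat.measurableSet_toEuclideanLin_eq hV c _, ?_, ?_⟩
    · have hae : ∀ᵐ x ∂(volume.restrict (Ω : Set (EuclideanSpace ℝ (Fin d)))),
          (V x).toEuclideanLin c = (Complex.I * β) • c := by
        filter_upwards [hc, CoupledHeat.coeFn_mulOperator hV u, Lp.coeFn_smul (Complex.I * β) u]
          with x h1 h2 h3
        rw [hVu, h3, Pi.smul_apply, h1] at h2
        exact h2.symm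
      refine measure_mono_null (fun x hx => ?_)
        (ae_iff.1 ((ae_restrict_iff' Ω.isOpen.measurableSet).1 hae))
      exact fun h => hx.2 ⟨hx.1, h hx.1⟩
    · refine (Submodule.ne_bot_iff _).2
        ⟨c, CoupledHeat.mem_iInf_ker_iff.2 fun x hx => hx.2, fun h0 => hu.1 ?_⟩
      rw [Lp.eq_zero_iff_ae_eq_zero]
      filter_upwards [hc] with x hx
      rw [hx, h0, Pi.zero_apply]
  · rintro ⟨Ω', -, -, hnull, hker⟩
    obtain ⟨c, hc, hc0⟩ := (Submodule.ne_bot_iff _).1 hker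
    rw [CoupledHeat.mem_iInf_ker_iff] at hc
    refine ⟨_, CoupledHeat.isEigenvector_const hΩ_conn.nonempty hA hV hc0 ?_⟩
    refine (ae_restrict_iff' Ω.isOpen.measurableSet).2 (ae_iff.2 (measure_mono_null ?_ hnull))
    intro x hx
    simp only [Set.mem_ofPred_eq, Classical.not_imp] at hx
    exact ⟨hx.1, fun h => hx.2 (hc x h)⟩
  · obtain ⟨⟨c, hc⟩, -⟩ := hconst u hu
    exact ⟨c k, hc.mono fun x hx => by rw [hx]⟩
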